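/- Let $n,k$ be nonnegative integers. Let $G_{k,n}$ be the set of sequences $\alpha=(\alpha_1,\dots,\alpha_k)$ of integers with $1\le\alpha_1\le\cdots\le\alpha_k\le n$, and let $m(\alpha)$ be the product of the factorials of the multiplicities of the distinct indices occurring in $\alpha$. For an $n\times n$ complex matrix $A$ and $\alpha,\beta\in G_{k,n}$, let $A[\alpha|\beta]$ be the $k\times k$ matrix whose $(r,s)$-entry is $a_{\alpha_r\beta_s}$. Let $\vee^kA$ denote the $k$-th symmetric tensor power of $A$, that is, the matrix of size $\binom{n+k-1}{k}$ indexed by $G_{k,n}$ whose $(\alpha,\beta)$-entry is $$\bigl(m(\alpha)m(\beta)\bigr)^{-1/2}\,\operatorname{per}A[\alpha|\beta],\qquad \operatorname{per}B=\sum_{\sigma\in S_k}\prod_{i=1}^k b_{i\sigma(i)}$$ (this is the matrix of the restriction of $A\otimes\cdots\otimes A$ to the symmetric tensors in $\otimes^k\mathbb C^n$, in the orthonormal basis $m(\alpha)^{-1/2}\,e_{\alpha_1}\vee\cdots\vee e_{\alpha_k}$, $\alpha\in G_{k,n}$, where $x_1\vee\cdots\vee x_k=(k!)^{-1/2}\sum_{\sigma\in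 S_k}x_{\sigma(1)}\otimes\cdots\otimes x_{\sigma(k)}$). Let $\|\cdot\|$ denote the operator norm of a matrix induced by the Euclidean norm. Then for all $n\times n$ complex matrices $A$ and $X$, $$\|\vee^k(A+X)-\vee^kA\|\le(\|A\|+\|X\|)^k-\|A\|^k.$$ -/

import Mathlib

open scoped Matrix.Norms.L2Operator

/-- `G_{k,n}`: nondecreasing sequences `α₁ ≤ ⋯ ≤ α_k` of indices from an `n`-element set. -/
abbrev MultiIndex (k n : ℕ) : Type := {α : Fin k → Fin n // Monotone α}

/-- `m(α) = m₁! ⋯ m_ℓ!`, the product of the factorials of the multiplicities of the distinct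
indices occurring in `α` (indices that do not occur contribute `0! = 1`). -/
def multFactorial {k n : ℕ} (α : MultiIndex k n) : ℕ :=
  ∏ i : Fin n, (Finset.univ.filter fun p : Fin k => α.1 p = i).card.factorial

/-- The `k`-th symmetric tensor power `∨ᵏ A` of an `n × n` complex matrix: the matrix, indexed by
`G_{k,n}`, of the restriction of `A ⊗ ⋯ ⊗ A` to the symmetric tensors with respect to the
orthonormal basis `m(α)^{-1/2} e_{α₁} ∨ ⋯ ∨ e_{α_k}`. Its `(α, β)` entry is
`(m(α) m(β))^{-1/2} per A[α|β]`, where `A[α|β]` has `(r, s)` entry `A_{α_r, β_s}`. -/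
noncomputable def symPower (k : ℕ) {n : ℕ} (A : Matrix (Fin n) (Fin n) ℂ) :
    Matrix (MultiIndex k n) (MultiIndex k n) ℂ :=
  Matrix.of fun α β =>
    (((Real.sqrt ((multFactorial α : ℝ) * (multFactorial β : ℝ)))⁻¹ : ℝ) : ℂ) *
      (A.submatrix α.1 β.1).permanent

/-! With U = `symInclusion`, the isometric inclusion of the symmetric tensors, ∨ᵏA = U* (A ⊗ ⋯ ⊗ A)
U, so compression reduces the estimate to full tensor powers. Expand (A + X)^{⊗k} over the sets s of
positions carrying A. The term s = univ cancels against A^{⊗k}; every other term has norm at most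
‖A‖^|s| ‖X‖^(k-|s|), and the binomial theorem sums these bounds. -/

open Matrix in
theorem sum_norm_sq_mulVec_le {ι κ : Type*} [Fintype ι] [Fintype κ] [DecidableEq κ]
    (A : Matrix ι κ ℂ) (v : κ → ℂ) :
    ∑ i, ‖(A *ᵥ v) i‖ ^ 2 ≤ ‖A‖ ^ 2 * ∑ j, ‖v j‖ ^ 2 := by
  have h := A.l2_opNorm_mulVec (WithLp.toLp 2 v)
  have h2 := pow_le_pow_left₀ (norm_nonneg _) h 2
  rw [mul_pow, EuclideanSpace.norm_sq_eq, EuclideanSpace.norm_sq_eq] at h2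
  exact h2

open Matrix in
theorem l2_opNorm_le_of_sum_norm_sq_le {ι κ : Type*} [Fintype ι] [Fintype κ] [DecidableEq κ]
    (A : Matrix ι κ ℂ) {c : ℝ} (hc : 0 ≤ c)
    (h : ∀ v : κ → ℂ, ∑ i, ‖(A *ᵥ v) i‖ ^ 2 ≤ c ^ 2 * ∑ j, ‖v j‖ ^ 2) : ‖A‖ ≤ c := by
  rw [Matrix.l2_opNorm_def]
  refine ContinuousLinearMap.opNorm_le_bound _ hc fun x => ?_
  refine (sq_le_sq₀ (norm_nonneg _) (by positivity)).mp ?_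
  rw [mul_pow, EuclideanSpace.norm_sq_eq, EuclideanSpace.norm_sq_eq]
  exact h x

/-- The tensor product `A₁ ⊗ ⋯ ⊗ A_k` of `k` matrices, in the basis of elementary tensors. -/
def tensorMatrix {k n : ℕ} (A : Fin k → Matrix (Fin n) (Fin n) ℂ) :
    Matrix (Fin k → Fin n) (Fin k → Fin n) ℂ :=
  Matrix.of fun f g => ∏ i, A i (f i) (g i)

theorem sum_norm_sq_tensorMatrix_mulVec_le {k n : ℕ} (A : Fin k → Matrix (Fin n) (Fin n) ℂ)
    (v : (Fin k → Fin n) → ℂ) :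
    ∑ f, ‖(tensorMatrix A).mulVec v f‖ ^ 2 ≤ (∏ i, ‖A i‖) ^ 2 * ∑ g, ‖v g‖ ^ 2 := by
  induction k with
  | zero => simp [tensorMatrix, Matrix.mulVec, dotProduct]
  | succ k ih =>
    let B : Fin k → Matrix (Fin n) (Fin n) ℂ := fun i => A i.succ
    have hsplit {M : Type} [AddCommMonoid M] (F : (Fin (k + 1) → Fin n) → M) :
        ∑ f, F f = ∑ a, ∑ f' : Fin k → Fin n, F (Fin.cons a f') := by
      rw [← (Fin.consEquiv fun _ => Fin n).sum_comp, Fintype.sum_prod_type]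
      rfl
    -- Factors 1, …, k act on each slice of `v` with first index `b`; `A 0` then acts on `b` alone.
    let w (f' : Fin k → Fin n) (b : Fin n) : ℂ :=
      (tensorMatrix B).mulVec (fun g' => v (Fin.cons b g')) f'
    have hmul (a : Fin n) (f' : Fin k → Fin n) :
        (tensorMatrix A).mulVec v (Fin.cons a f') = (A 0).mulVec (w f') a := by
      simp only [Matrix.mulVec, dotProduct, hsplit, w, tensorMatrix, Matrix.of_apply,
        Fin.prod_univ_succ, Fin.cons_zero, Fin.cons_succ, Finset.mul_sum, B, mul_assoc]
    calc ∑ f, ‖(tensorMatrix A).mulVec v f‖ ^ 2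
        = ∑ f' : Fin k → Fin n, ∑ a, ‖(A 0).mulVec (w f') a‖ ^ 2 := by
          rw [hsplit, Finset.sum_comm]; simp only [hmul]
      _ ≤ ∑ f' : Fin k → Fin n, ‖A 0‖ ^ 2 * ∑ b, ‖w f' b‖ ^ 2 :=
          Finset.sum_le_sum fun f' _ => sum_norm_sq_mulVec_le _ _
      _ = ‖A 0‖ ^ 2 * ∑ b, ∑ f' : Fin k → Fin n, ‖w f' b‖ ^ 2 := by
          rw [← Finset.mul_sum, Finset.sum_comm]
      _ ≤ ‖A 0‖ ^ 2 * ∑ b, (∏ i, ‖B i‖) ^ 2 * ∑ g' : Fin k → Fin n, ‖v (Fin.cons b g')‖ ^ 2 := by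
          gcongr with b
          exact ih B _
      _ = (∏ i, ‖A i‖) ^ 2 * ∑ g, ‖v g‖ ^ 2 := by
          rw [← Finset.mul_sum, hsplit, Fin.prod_univ_succ]; ring

theorem norm_tensorMatrix_le {k n : ℕ} (A : Fin k → Matrix (Fin n) (Fin n) ℂ) :
    ‖tensorMatrix A‖ ≤ ∏ i, ‖A i‖ :=
  l2_opNorm_le_of_sum_norm_sq_le _ (Finset.prod_nonneg fun _ _ => norm_nonneg _)
    (sum_norm_sq_tensorMatrix_mulVec_le A)

theorem tensorMatrix_add {k n : ℕ} (A X : Matrix (Fin n) (Fin n) ℂ) :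
    tensorMatrix (fun _ : Fin k => A + X) =
      ∑ s : Finset (Fin k), tensorMatrix (fun i => if i ∈ s then A else X) := by
  ext f g
  simp only [tensorMatrix, Matrix.of_apply, Matrix.sum_apply, Matrix.add_apply, Finset.prod_add,
    Finset.powerset_univ]
  refine Finset.sum_congr rfl fun s _ => ?_
  rw [← Finset.prod_mul_prod_compl s, Finset.compl_eq_univ_sdiff]
  congr 1
  · exact Finset.prod_congr rfl fun i hi => by rw [if_pos hi]
  · exact Finset.prod_congr rfl fun i hi => by rw [if_neg (Finset.mem_sdiff.mp hi).2]

theorem norm_tensorMatrix_add_sub_le {k n : ℕ} (A X : Matrix (Fin n) (Fin n) ℂ) :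
    ‖tensorMatrix (fun _ : Fin k => A + X) - tensorMatrix (fun _ : Fin k => A)‖ ≤
      (‖A‖ + ‖X‖) ^ k - ‖A‖ ^ k := by
  have hA : tensorMatrix (fun _ : Fin k => A) =
      tensorMatrix (fun i : Fin k => if i ∈ Finset.univ then A else X) := by simp
  have hpow : (‖A‖ + ‖X‖) ^ k =
      ∑ s : Finset (Fin k), ‖A‖ ^ s.card * ‖X‖ ^ (k - s.card) := by
    rw [Fin.sum_pow_mul_eq_add_pow]
  rw [tensorMatrix_add, hA, ← Finset.sum_erase_eq_sub (Finset.mem_univ _), hpow]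
  have hk : ‖A‖ ^ k = ‖A‖ ^ (Finset.univ : Finset (Fin k)).card *
      ‖X‖ ^ (k - (Finset.univ : Finset (Fin k)).card) := by simp
  rw [hk, ← Finset.sum_erase_eq_sub (Finset.mem_univ _)]
  refine norm_sum_le_of_le _ fun s _ => (norm_tensorMatrix_le _).trans_eq ?_
  simp only [apply_ite, Finset.prod_ite, Finset.prod_const, Finset.filter_not]
  simp [← Finset.compl_eq_univ_sdiff, Finset.card_compl]

/-- The matrix of the inclusion of the symmetric tensors into `⊗ᵏ ℂⁿ`, from the basis
`m(α)^{-1/2} e_{α₁} ∨ ⋯ ∨ e_{α_k}` to the basis of elementary tensors. -/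
noncomputable def symInclusion (k n : ℕ) : Matrix (Fin k → Fin n) (MultiIndex k n) ℂ :=
  Matrix.of fun f α =>
    (((Real.sqrt ((k.factorial : ℝ) * multFactorial α))⁻¹ : ℝ) : ℂ) *
      ∑ σ : Equiv.Perm (Fin k), if f = α.1 ∘ σ then 1 else 0

/-- Used twice: M = A^{⊗k} yields the permanents, M = 1 the orthonormality of the columns of U. -/
theorem symInclusion_conj_apply {k n : ℕ} (M : Matrix (Fin k → Fin n) (Fin k → Fin n) ℂ)
    (α β : MultiIndex k n) :
    ((symInclusion k n).conjTranspose * M * symInclusion k n) α β =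
      (((Real.sqrt ((multFactorial α : ℝ) * multFactorial β))⁻¹ : ℝ) : ℂ) *
        ((k.factorial : ℂ)⁻¹ *
          ∑ σ : Equiv.Perm (Fin k), ∑ τ : Equiv.Perm (Fin k), M (α.1 ∘ σ) (β.1 ∘ τ)) := by
  have hleft (g : Fin k → Fin n) : ((symInclusion k n).conjTranspose * M) α g =
      (((Real.sqrt ((k.factorial : ℝ) * multFactorial α))⁻¹ : ℝ) : ℂ) *
        ∑ σ : Equiv.Perm (Fin k), M (α.1 ∘ σ) g := by
    simp only [Matrix.mul_apply, Matrix.conjTranspose_apply, symInclusion, Matrix.of_apply,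
      star_mul', star_sum, apply_ite star, star_one, star_zero, mul_assoc, ← Finset.mul_sum,
      Finset.sum_mul, RCLike.star_def, Complex.conj_ofReal]
    rw [Finset.sum_comm]
    simp
  have hscalar : (Real.sqrt ((k.factorial : ℝ) * multFactorial α))⁻¹ *
      (Real.sqrt ((k.factorial : ℝ) * multFactorial β))⁻¹ =
      (Real.sqrt ((multFactorial α : ℝ) * multFactorial β))⁻¹ * (k.factorial : ℝ)⁻¹ := by
    rw [Real.sqrt_mul (by positivity), Real.sqrt_mul (by positivity),
      Real.sqrt_mul (by positivity), ← mul_inv, ← mul_inv]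
    congr 1
    rw [mul_mul_mul_comm, Real.mul_self_sqrt (by positivity)]
    ring
  have hscalar' := congrArg (fun x : ℝ => (x : ℂ)) hscalar
  simp only [Complex.ofReal_mul] at hscalar'
  rw [Matrix.mul_apply]
  simp only [hleft]
  simp only [symInclusion, Matrix.of_apply]
  rw [← mul_assoc (((Real.sqrt ((multFactorial α : ℝ) * multFactorial β))⁻¹ : ℝ) : ℂ)]
  rw [show ((k.factorial : ℂ)⁻¹) = (((k.factorial : ℝ)⁻¹ : ℝ) : ℂ) by push_cast; rfl, ← hscalar']
  simp only [mul_mul_mul_comm, ← Finset.mul_sum]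
  congr 1
  simp only [Finset.mul_sum, mul_ite, mul_one, mul_zero]
  rw [Finset.sum_comm]
  simp only [Finset.sum_ite_eq', Finset.mem_univ, if_true]
  rw [Finset.sum_comm]

/-- By invariance under simultaneous right translation, each τ contributes as much as τ = 1; the
resulting k! cancels the normalisation of U. -/
theorem sum_perm_perm_eq {k : ℕ} {M : Type*} [AddCommMonoid M]
    (F : Equiv.Perm (Fin k) → Equiv.Perm (Fin k) → M)
    (hF : ∀ σ τ ρ, F (σ * ρ) (τ * ρ) = F σ τ) :
    ∑ σ, ∑ τ, F σ τ = k.factorial • ∑ σ, F σ 1 := by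
  rw [Finset.sum_comm]
  have h (τ : Equiv.Perm (Fin k)) : ∑ σ, F σ τ = ∑ σ, F σ 1 := by
    rw [← Equiv.sum_comp (Equiv.mulRight τ)]
    refine Finset.sum_congr rfl fun σ _ => ?_
    simpa using hF σ 1 τ
  simp [h, Fintype.card_perm]

theorem symPower_eq_conj_tensorMatrix {k n : ℕ} (A : Matrix (Fin n) (Fin n) ℂ) :
    symPower k A =
      (symInclusion k n).conjTranspose * tensorMatrix (fun _ : Fin k => A) *
        symInclusion k n := by
  ext α β
  rw [symInclusion_conj_apply, sum_perm_perm_eq, nsmul_eq_mul,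
    inv_mul_cancel_left₀ (by exact_mod_cast k.factorial_ne_zero)]
  · rfl
  · intro σ τ ρ
    exact Equiv.prod_comp ρ fun i => A (α.1 (σ i)) (β.1 (τ i))

/-- The stabilizer of α is the product of the symmetric groups of its fibres. -/
theorem card_perm_comp_eq_multFactorial {k n : ℕ} (α : MultiIndex k n) :
    (Finset.univ.filter fun σ : Equiv.Perm (Fin k) => α.1 ∘ σ = α.1).card =
      multFactorial α := by
  rw [← Fintype.card_subtype, DomMulAct.stabilizer_card, multFactorial]
  simp only [Fintype.card_subtype]

theorem symInclusion_conjTranspose_mul_self (k n : ℕ) :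
    (symInclusion k n).conjTranspose * symInclusion k n = 1 := by
  ext α β
  have h := symInclusion_conj_apply (1 : Matrix (Fin k → Fin n) (Fin k → Fin n) ℂ) α β
  rw [Matrix.mul_one] at h
  rw [h, sum_perm_perm_eq, nsmul_eq_mul,
    inv_mul_cancel_left₀ (by exact_mod_cast k.factorial_ne_zero)]
  · simp only [Matrix.one_apply, Equiv.Perm.coe_one, Function.comp_id]
    by_cases hαβ : α = β
    · subst hαβ
      have hm : (multFactorial α : ℂ) ≠ 0 := by
        exact_mod_cast (Finset.prod_pos fun _ _ => Nat.factorial_pos _).ne'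
      have hsum : (∑ σ : Equiv.Perm (Fin k), if α.1 ∘ σ = α.1 then (1 : ℂ) else 0) =
          multFactorial α := by
        rw [Finset.sum_boole, card_perm_comp_eq_multFactorial]
      rw [if_pos rfl, Real.sqrt_mul_self (by positivity)]
      refine (congrArg _ ?_).trans (b := (((multFactorial α : ℝ)⁻¹ : ℝ) : ℂ) * multFactorial α) ?_
      · convert! hsum
      push_cast
      exact inv_mul_cancel₀ hm
    · rw [if_neg hαβ, Finset.sum_eq_zero, mul_zero]
      intro σ _
      refine if_neg fun hσ => hαβ (Subtype.ext ?_)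
      -- Two nondecreasing rearrangements of the same sequence coincide.
      have := Tuple.unique_monotone (f := α.1) (σ := 1) (τ := σ) α.2 (hσ ▸ β.2)
      exact this.trans hσ
  · intro σ τ ρ
    simp only [Matrix.one_apply, Equiv.Perm.coe_mul, ← Function.comp_assoc]
    simp only [ρ.surjective.injective_comp_right.eq_iff]

theorem norm_symInclusion_le (k n : ℕ) : ‖symInclusion k n‖ ≤ 1 := by
  have h := (symInclusion k n).l2_opNorm_conjTranspose_mul_self
  rw [symInclusion_conjTranspose_mul_self, ← Matrix.diagonal_one, Matrix.l2_opNorm_diagonal] at h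
  -- Only `≤`: for n = 0 < k the index type is empty and the norm is 0.
  have h1 : ‖fun _ : MultiIndex k n => (1 : ℂ)‖ ≤ 1 :=
    (pi_norm_const_le (1 : ℂ)).trans_eq norm_one
  have h2 : ‖symInclusion k n‖ * ‖symInclusion k n‖ ≤ 1 := h ▸ h1
  nlinarith [norm_nonneg (symInclusion k n)]

theorem norm_symInclusion_conj_le {k n : ℕ} (M : Matrix (Fin k → Fin n) (Fin k → Fin n) ℂ) :
    ‖(symInclusion k n).conjTranspose * M * symInclusion k n‖ ≤ ‖M‖ := by
  have hU := norm_symInclusion_le k n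
  calc _ ≤ ‖(symInclusion k n).conjTranspose * M‖ * ‖symInclusion k n‖ := Matrix.l2_opNorm_mul _ _
    _ ≤ ‖(symInclusion k n).conjTranspose * M‖ := mul_le_of_le_one_right (norm_nonneg _) hU
    _ ≤ ‖(symInclusion k n).conjTranspose‖ * ‖M‖ := Matrix.l2_opNorm_mul _ _
    _ ≤ ‖M‖ := by
      rw [Matrix.l2_opNorm_conjTranspose]
      exact mul_le_of_le_one_left (norm_nonneg _) hU

theorem mainTheorem4 (n k : ℕ) (A X : Matrix (Fin n) (Fin n) ℂ) :
    ‖symPower k (A + X) - symPower k A‖ ≤ (‖A‖ + ‖X‖) ^ k - ‖A‖ ^ k := by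
  rw [symPower_eq_conj_tensorMatrix, symPower_eq_conj_tensorMatrix, ← Matrix.sub_mul,
    ← Matrix.mul_sub]
  exact (norm_symInclusion_conj_le _).trans (norm_tensorMatrix_add_sub_le A X)
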